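/- For $\alpha>0$ and $c>0$ let $\operatorname{Par}(\alpha,c)$ denote the Pareto distribution with shape $\alpha$ and scale $c$, that is, the probability distribution on $\mathbb{R}$ with density $f(t)=\alpha c^{\alpha}t^{-\alpha-1}1(t>c)$. For probability distributions $\mu,\nu$ on $\mathbb{R}$ write $\mu\le_{\mathrm{cx}}\nu$ (respectively $\mu\le_{\mathrm{icx}}\nu$, $\mu\le_{\mathrm{icv}}\nu$) if $\int\phi\,d\mu\le\int\phi\,d\nu$ for all convex (respectively nondecreasing convex, nondecreasing concave) functions $\phi:\mathbb{R}\to\mathbb{R}$ that are integrable with respect to both $\mu$ and $\nu$. Theorem. For $i=1,2$ let $\mu_i=\operatorname{Par}(\alpha_i,c_i)$ with $\alpha_i>1$ and $c_i>0$. Then $\mu_i$ has the finite mean $\lambda_i=c_i(1-1/\alpha_i)^{-1}$, and: (i) $\mu_1\le_{\mathrm{icx}}\mu_2$ if and only if $\lambda_1\le\lambda_2$ and $\alpha_1\ge\alpha_2$. (ii) $\mu_1\le_{\mathrm{cx}}\mu_2$ if and only if $\lambda_1=\lambda_2$ and $\alpha_1\ge\alpha_2$. (iii) $\mu_1\le_{\mathrm{icv}}\mu_2$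 if and only if $\lambda_1\le\lambda_2$ and $c_1\le c_2$. -/

import Mathlib

/-- The Pareto distribution `Par(α, c)` with shape `α` and scale `c`
(Mathlib's `paretoMeasure` takes the scale first). -/
noncomputable def Par (α c : ℝ) : MeasureTheory.Measure ℝ :=
  ProbabilityTheory.paretoMeasure c α

/-- The mean (first moment) of a distribution on the real line. -/
noncomputable def distMean (μ : MeasureTheory.Measure ℝ) : ℝ :=
  ∫ x, x ∂μ

/-- The integral stochastic order generated by a class `C` of test functions: `∫ φ dμ ≤ ∫ φ dν`
for all `φ ∈ C` such that both integrals exist. -/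
def IntegralOrder (C : Set (ℝ → ℝ)) (μ ν : MeasureTheory.Measure ℝ) : Prop :=
  ∀ φ ∈ C, MeasureTheory.Integrable φ μ → MeasureTheory.Integrable φ ν →
    ∫ x, φ x ∂μ ≤ ∫ x, φ x ∂ν

/-- The convex stochastic order. -/
def ConvexOrder (μ ν : MeasureTheory.Measure ℝ) : Prop :=
  IntegralOrder {φ | ConvexOn ℝ Set.univ φ} μ ν

/-- The increasing convex stochastic order (increasing means nondecreasing). -/
def IncreasingConvexOrder (μ ν : MeasureTheory.Measure ℝ) : Prop :=
  IntegralOrder {φ | Monotone φ ∧ ConvexOn ℝ Set.univ φ} μ ν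

/-- The increasing concave stochastic order (increasing means nondecreasing). -/
def IncreasingConcaveOrder (μ ν : MeasureTheory.Measure ℝ) : Prop :=
  IntegralOrder {φ | Monotone φ ∧ ConcaveOn ℝ Set.univ φ} μ ν

open MeasureTheory ProbabilityTheory Real Set Filter Topology

/-! The map `T x = c₂ (x / c₁) ^ (α₁ / α₂)` carries the first law to the second, and `T x / x` is a
multiple of a power of `x`. If `α₂ < α₁`, then `T` crosses the identity at most once, from below.
With `x₀` the crossing point and `φ'` the right derivative of a convex `φ`, `φ (T x) - φ x ≥ φ' x *
(T x - x) ≥ φ' x₀ * (T x - x)`; integrating bounds the difference of the integrals below by `φ' x₀`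
times the difference of the means (`ConvexOn.exists_mul_distMean_sub_le_Par`). The sign of `φ' x₀`,
or equality of the means, settles sufficiency, except for icv with `α₂ ≤ α₁`, where `T x ≥ x`.

Necessity comes from test functions: `x` and `-x` for the means, powers near the critical moment for
the shapes, `min x c₁` for the scales. -/

/-- The right derivative of a convex function is a subgradient. -/
lemma ConvexOn.add_rightDeriv_mul_le {φ : ℝ → ℝ} (hφ : ConvexOn ℝ univ φ) (x y : ℝ) :
    φ x + derivWithin φ (Ioi x) x * (y - x) ≤ φ y := by
  have hx : x ∈ interior (univ : Set ℝ) := by simp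
  rcases lt_trichotomy x y with h | rfl | h
  · have := hφ.rightDeriv_le_slope (mem_univ x) (mem_univ y) h
      (hφ.differentiableWithinAt_Ioi_of_mem_interior hx)
    rw [slope_def_field, le_div_iff₀ (by linarith)] at this
    linarith
  · simp
  · have := (hφ.slope_le_leftDeriv (mem_univ y) (mem_univ x) h
      (hφ.differentiableWithinAt_Iio_of_mem_interior hx)).trans
      (hφ.leftDeriv_le_rightDeriv_of_mem_interior hx)
    rw [slope_def_field, div_le_iff₀ (by linarith)] at this
    linarith

/-- If a transport map moves mass away from `x₀`, then the integral of a convex function increases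
by at least the slope at `x₀` times the increase of the mean. -/
lemma ConvexOn.mul_integral_sub_le_of_expansive {μ : Measure ℝ} {φ T : ℝ → ℝ}
    (hφ : ConvexOn ℝ univ φ) (x₀ : ℝ)
    (hT : ∀ᵐ x ∂μ, (x₀ ≤ x → x ≤ T x) ∧ (x ≤ x₀ → T x ≤ x))
    (hi : Integrable (fun x => x) μ) (hiT : Integrable T μ)
    (hiφ : Integrable φ μ) (hiφT : Integrable (fun x => φ (T x)) μ) :
    derivWithin φ (Ioi x₀) x₀ * (∫ x, T x ∂μ - ∫ x, x ∂μ) ≤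
      ∫ x, φ (T x) ∂μ - ∫ x, φ x ∂μ := by
  rw [← integral_sub hiT hi, ← integral_sub hiφT hiφ, ← integral_const_mul]
  refine integral_mono_ae ((hiT.sub hi).const_mul _) (hiφT.sub hiφ) ?_
  have hmono : Monotone fun x => derivWithin φ (Ioi x) x := fun x y hxy =>
    hφ.monotoneOn_rightDeriv (by simp) (by simp) hxy
  filter_upwards [hT] with x hx
  have hsub := hφ.add_rightDeriv_mul_le x (T x)
  -- Both factors change sign at `x₀`, in the same direction.
  have : 0 ≤ (derivWithin φ (Ioi x) x - derivWithin φ (Ioi x₀) x₀) * (T x - x) := by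
    rcases le_total x₀ x with h | h
    · exact mul_nonneg (sub_nonneg.2 (hmono h)) (sub_nonneg.2 (hx.1 h))
    · exact mul_nonneg_of_nonpos_of_nonpos (sub_nonpos.2 (hmono h)) (sub_nonpos.2 (hx.2 h))
  linarith

lemma ConvexOn.rightDeriv_nonneg_of_monotone {φ : ℝ → ℝ} (hφ : ConvexOn ℝ univ φ)
    (hm : Monotone φ) (x : ℝ) : 0 ≤ derivWithin φ (Ioi x) x := by
  have h₁ := hφ.add_rightDeriv_mul_le x (x - 1)
  have h₂ : φ (x - 1) ≤ φ x := hm (by linarith)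
  linarith

lemma ConvexOn.rightDeriv_nonpos_of_antitone {φ : ℝ → ℝ} (hφ : ConvexOn ℝ univ φ)
    (hm : Antitone φ) (x : ℝ) : derivWithin φ (Ioi x) x ≤ 0 := by
  have h₁ := hφ.add_rightDeriv_mul_le x (x + 1)
  have h₂ : φ (x + 1) ≤ φ x := hm (by linarith)
  linarith

/-- Truncation at `0` keeps the power convex on the whole line and changes nothing on the Pareto
support. -/
lemma convexOn_max_rpow {p : ℝ} (hp : 1 ≤ p) :
    ConvexOn ℝ univ fun x : ℝ => (max x 0) ^ p := by
  have hr : (fun x : ℝ => max x 0) '' univ ⊆ Ici 0 := by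
    rintro _ ⟨x, -, rfl⟩
    exact le_max_right x 0
  have hmax : ConvexOn ℝ univ fun x : ℝ => max x 0 :=
    (convexOn_id convex_univ).sup (convexOn_const 0 convex_univ)
  refine ConvexOn.comp (g := fun x : ℝ => x ^ p) ((convexOn_rpow hp).subset hr ?_) hmax ?_
  · exact (isPreconnected_univ.image _ (by fun_prop)).ordConnected.convex
  · exact (monotoneOn_rpow_Ici_of_exponent_nonneg (by linarith)).mono hr

lemma monotone_max_rpow {p : ℝ} (hp : 0 ≤ p) : Monotone fun x : ℝ => (max x 0) ^ p :=
  fun _ _ h => rpow_le_rpow (le_max_right _ _) (max_le_max_right 0 h) hp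

/-! ### Tails and moments of Pareto laws -/

section Pareto

variable {α c : ℝ}

lemma isProbabilityMeasure_Par (hα : 0 < α) (hc : 0 < c) : IsProbabilityMeasure (Par α c) :=
  isProbabilityMeasure_paretoMeasure hc hα

lemma measurable_paretoPDF (c α : ℝ) : Measurable (paretoPDF c α) :=
  (measurable_paretoPDFReal c α).ennreal_ofReal

lemma Par_Ici (hα : 0 < α) (hc : 0 < c) {x : ℝ} (hx : c ≤ x) :
    Par α c (Ici x) = ENNReal.ofReal ((c / x) ^ α) := by
  have hx0 : 0 < x := hc.trans_le hx
  have hint : IntegrableOn (fun y : ℝ => α * c ^ α * y ^ (-(α + 1))) (Ioi x) :=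
    (integrableOn_Ioi_rpow_of_lt (by linarith) hx0).const_mul _
  rw [Par, paretoMeasure, withDensity_apply _ measurableSet_Ici,
    setLIntegral_congr_fun measurableSet_Ici
      (fun y (hy : x ≤ y) => paretoPDF_of_le (r := α) (hx.trans hy)),
    setLIntegral_congr Ioi_ae_eq_Ici.symm, ← ofReal_integral_eq_lintegral_ofReal hint,
    integral_const_mul, integral_Ioi_rpow_of_lt (by linarith) hx0]
  · congr 1
    rw [div_rpow hc.le hx0.le, show -(α + 1) + 1 = -α by ring, rpow_neg hx0.le]
    field_simp
  · refine (ae_restrict_iff' measurableSet_Ioi).2 (ae_of_all _ fun y (hy : x < y) => ?_)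
    have : 0 < y := hx0.trans hy
    simp only [Pi.zero_apply]
    positivity

lemma Par_Ici_of_le (hα : 0 < α) (hc : 0 < c) {x : ℝ} (hx : x ≤ c) : Par α c (Ici x) = 1 := by
  have := isProbabilityMeasure_Par hα hc
  refine le_antisymm prob_le_one ?_
  have h : Par α c (Ici c) = 1 := by
    rw [Par_Ici hα hc le_rfl, div_self hc.ne', one_rpow, ENNReal.ofReal_one]
  exact h ▸ measure_mono (Ici_subset_Ici.2 hx)

lemma ae_le_Par (hα : 0 < α) (hc : 0 < c) : ∀ᵐ x ∂(Par α c), c ≤ x := by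
  have := isProbabilityMeasure_Par hα hc
  exact (prob_compl_eq_zero_iff measurableSet_Ici).2 (Par_Ici_of_le hα hc le_rfl)

/-- The density times a power is a power function on the half-line. -/
lemma paretoPDF_toReal_smul_max_rpow (hα : 0 < α) (hc : 0 < c) (p : ℝ) :
    (fun x => (paretoPDF c α x).toReal • (max x 0) ^ p) =
      (Ici c).indicator fun x => α * c ^ α * x ^ (p - α - 1) := by
  ext x
  rw [paretoPDF, ENNReal.toReal_ofReal (paretoPDFReal_nonneg hc.le hα.le x), smul_eq_mul,
    paretoPDFReal, indicator_apply]
  by_cases h : c ≤ x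
  · have hx : 0 < x := hc.trans_le h
    rw [if_pos h, if_pos (mem_Ici.2 h), max_eq_left hx.le, mul_assoc, ← rpow_add hx]
    ring_nf
  · rw [if_neg h, if_neg (by simpa using h), zero_mul]

lemma integrable_max_rpow_Par (hα : 0 < α) (hc : 0 < c) {p : ℝ} (hp : p < α) :
    Integrable (fun x => (max x 0) ^ p) (Par α c) := by
  rw [Par, paretoMeasure, integrable_withDensity_iff_integrable_smul' (measurable_paretoPDF c α)
    (ae_of_all _ fun _ => ENNReal.ofReal_lt_top), paretoPDF_toReal_smul_max_rpow hα hc,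
    integrable_indicator_iff measurableSet_Ici, integrableOn_Ici_iff_integrableOn_Ioi]
  exact (integrableOn_Ioi_rpow_of_lt (by linarith) hc).const_mul _

lemma integral_max_rpow_Par (hα : 0 < α) (hc : 0 < c) {p : ℝ} (hp : p < α) :
    ∫ x, (max x 0) ^ p ∂(Par α c) = α * c ^ p / (α - p) := by
  rw [Par, paretoMeasure, integral_withDensity_eq_integral_toReal_smul (measurable_paretoPDF c α)
    (ae_of_all _ fun _ => ENNReal.ofReal_lt_top), paretoPDF_toReal_smul_max_rpow hα hc,
    integral_indicator measurableSet_Ici, integral_Ici_eq_integral_Ioi, integral_const_mul,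
    integral_Ioi_rpow_of_lt (by linarith) hc, show p - α - 1 + 1 = -(α - p) by ring, neg_div_neg_eq,
    mul_div_assoc', mul_assoc, ← rpow_add hc]
  ring_nf

lemma max_rpow_one_ae_eq_Par (hα : 0 < α) (hc : 0 < c) :
    (fun x : ℝ => (max x 0) ^ (1 : ℝ)) =ᵐ[Par α c] fun x => x := by
  filter_upwards [ae_le_Par hα hc] with x hx
  rw [rpow_one, max_eq_left (hc.le.trans hx)]

lemma integrable_id_Par (hα : 1 < α) (hc : 0 < c) : Integrable (fun x : ℝ => x) (Par α c) :=
  (integrable_max_rpow_Par (by linarith) hc hα).congr (max_rpow_one_ae_eq_Par (by linarith) hc)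

lemma distMean_Par (hα : 1 < α) (hc : 0 < c) : distMean (Par α c) = c * (1 - 1 / α)⁻¹ := by
  have hα0 : 0 < α := by linarith
  have h : α - 1 ≠ 0 := by linarith
  rw [distMean, ← integral_congr_ae (max_rpow_one_ae_eq_Par hα0 hc),
    integral_max_rpow_Par hα0 hc hα, rpow_one]
  have : 1 - 1 / α = (α - 1) / α := by field_simp
  rw [this, inv_div]
  ring

end Pareto

/-! ### Monotone transport between Pareto laws -/

/-- The monotone transport map from `Par α₁ c₁` to `Par α₂ c₂`. -/
noncomputable def parTransport (α₁ c₁ α₂ c₂ : ℝ) (x : ℝ) : ℝ :=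
  c₂ * (max x c₁ / c₁) ^ (α₁ / α₂)

section Transport

variable {α₁ c₁ α₂ c₂ : ℝ}

lemma measurable_parTransport : Measurable (parTransport α₁ c₁ α₂ c₂) := by
  unfold parTransport
  fun_prop

lemma le_parTransport (hα₁ : 0 < α₁) (hα₂ : 0 < α₂) (hc₁ : 0 < c₁) (hc₂ : 0 < c₂) (x : ℝ) :
    c₂ ≤ parTransport α₁ c₁ α₂ c₂ x := by
  refine le_mul_of_one_le_right hc₂.le (one_le_rpow ?_ (by positivity))
  rw [one_le_div hc₁]
  exact le_max_right _ _

lemma map_parTransport (hα₁ : 0 < α₁) (hα₂ : 0 < α₂) (hc₁ : 0 < c₁) (hc₂ : 0 < c₂) :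
    (Par α₁ c₁).map (parTransport α₁ c₁ α₂ c₂) = Par α₂ c₂ := by
  have := isProbabilityMeasure_Par hα₁ hc₁
  refine Measure.ext_of_Ici _ _ fun y => ?_
  rw [Measure.map_apply measurable_parTransport measurableSet_Ici]
  rcases le_or_gt y c₂ with hy | hy
  · rw [Par_Ici_of_le hα₂ hc₂ hy]
    convert measure_univ (μ := Par α₁ c₁)
    exact eq_univ_of_forall fun x => hy.trans (le_parTransport hα₁ hα₂ hc₁ hc₂ x)
  · have hy0 : 0 < y := hc₂.trans hy
    have hone : 1 < y / c₂ := (one_lt_div hc₂).2 hy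
    -- The threshold lies above `c₁`, so the truncation in the map does not affect the preimage.
    have hgt : c₁ < c₁ * (y / c₂) ^ (α₂ / α₁) :=
      lt_mul_of_one_lt_right hc₁ (one_lt_rpow hone (by positivity))
    have hpre : parTransport α₁ c₁ α₂ c₂ ⁻¹' Ici y = Ici (c₁ * (y / c₂) ^ (α₂ / α₁)) := by
      ext x
      have hm : 0 < max x c₁ := hc₁.trans_le (le_max_right _ _)
      have h₁ : y ≤ parTransport α₁ c₁ α₂ c₂ x ↔ y / c₂ ≤ (max x c₁ / c₁) ^ (α₁ / α₂) := by
        rw [parTransport, div_le_iff₀' hc₂]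
      have h₂ : y / c₂ ≤ (max x c₁ / c₁) ^ (α₁ / α₂) ↔
          (y / c₂) ^ (α₂ / α₁) ≤ max x c₁ / c₁ := by
        rw [← inv_div α₂ α₁, le_rpow_inv_iff_of_pos (by positivity) (by positivity) (by positivity)]
      rw [mem_preimage, mem_Ici, mem_Ici, h₁, h₂, le_div_iff₀' hc₁, le_max_iff]
      exact or_iff_left hgt.not_ge
    rw [hpre, Par_Ici hα₁ hc₁ hgt.le, Par_Ici hα₂ hc₂ hy.le]
    congr 1
    rw [div_mul_cancel_left₀ hc₁.ne', ← inv_rpow (by positivity), inv_div,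
      ← rpow_mul (by positivity), div_mul_cancel₀ _ hα₁.ne']

lemma integrable_comp_parTransport (hα₁ : 0 < α₁) (hα₂ : 0 < α₂) (hc₁ : 0 < c₁) (hc₂ : 0 < c₂)
    {φ : ℝ → ℝ} (hφ : Integrable φ (Par α₂ c₂)) :
    Integrable (fun x => φ (parTransport α₁ c₁ α₂ c₂ x)) (Par α₁ c₁) := by
  rw [← map_parTransport hα₁ hα₂ hc₁ hc₂] at hφ
  exact hφ.comp_measurable measurable_parTransport

lemma integral_comp_parTransport (hα₁ : 0 < α₁) (hα₂ : 0 < α₂) (hc₁ : 0 < c₁) (hc₂ : 0 < c₂)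
    {φ : ℝ → ℝ} (hφ : Integrable φ (Par α₂ c₂)) :
    ∫ x, φ (parTransport α₁ c₁ α₂ c₂ x) ∂(Par α₁ c₁) = ∫ x, φ x ∂(Par α₂ c₂) := by
  have h := map_parTransport hα₁ hα₂ hc₁ hc₂
  rw [← h] at hφ ⊢
  exact (integral_map measurable_parTransport.aemeasurable hφ.aestronglyMeasurable).symm

lemma parTransport_eq_mul (hc₁ : 0 < c₁) {x : ℝ} (hx : c₁ ≤ x) :
    parTransport α₁ c₁ α₂ c₂ x = c₂ / c₁ * (x / c₁) ^ (α₁ / α₂ - 1) * x := by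
  have hx0 : 0 < x := hc₁.trans_le hx
  rw [parTransport, max_eq_left hx, rpow_sub (by positivity), rpow_one]
  field_simp

/-- A smaller shape or a larger scale with the same shape makes the transport map expansive
about some point. -/
lemma exists_parTransport_expansive (hα₂ : 0 < α₂) (hc₁ : 0 < c₁) (hc₂ : 0 < c₂)
    (h : α₂ < α₁ ∨ α₂ = α₁ ∧ c₁ ≤ c₂) :
    ∃ x₀, ∀ x, c₁ ≤ x → (x₀ ≤ x → x ≤ parTransport α₁ c₁ α₂ c₂ x) ∧
      (x ≤ x₀ → parTransport α₁ c₁ α₂ c₂ x ≤ x) := by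
  rcases h with h | ⟨rfl, h⟩
  · have hβ : 0 < α₁ / α₂ - 1 := by
      rw [sub_pos, one_lt_div hα₂]
      exact h
    set β := α₁ / α₂ - 1 with hβdef
    -- The solution of `c₂ / c₁ * (x / c₁) ^ β = 1`; it may lie below `c₁`.
    refine ⟨c₁ * (c₁ / c₂) ^ β⁻¹, fun x hx => ?_⟩
    have hx0 : 0 < x := hc₁.trans_le hx
    have hpow : c₂ / c₁ * ((c₁ / c₂) ^ β⁻¹) ^ β = 1 := by
      rw [rpow_inv_rpow (by positivity) hβ.ne']
      field_simp
    rw [parTransport_eq_mul hc₁ hx, ← hβdef]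
    constructor <;> intro hxx
    · refine le_mul_of_one_le_left hx0.le ?_
      rw [← hpow]
      gcongr
      rwa [le_div_iff₀' hc₁]
    · refine mul_le_of_le_one_left hx0.le ?_
      rw [← hpow]
      gcongr
      rwa [div_le_iff₀' hc₁]
  -- For equal shapes the map is a dilation, so a point below the support serves.
  · refine ⟨0, fun x hx => ⟨fun _ => ?_, fun h0 => absurd h0 (by linarith)⟩⟩
    have hx0 : 0 < x := hc₁.trans_le hx
    rw [parTransport_eq_mul hc₁ hx, div_self hα₂.ne', sub_self, rpow_zero, mul_one]
    exact le_mul_of_one_le_left hx0.le ((one_le_div hc₁).2 h)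

lemma le_parTransport_self (hα₂ : 0 < α₂) (hc₁ : 0 < c₁) (h : α₂ ≤ α₁)
    (hc : c₁ ≤ c₂) {x : ℝ} (hx : c₁ ≤ x) : x ≤ parTransport α₁ c₁ α₂ c₂ x := by
  have hx0 : 0 < x := hc₁.trans_le hx
  rw [parTransport_eq_mul hc₁ hx]
  refine le_mul_of_one_le_left hx0.le (one_le_mul_of_one_le_of_one_le ?_ (one_le_rpow ?_ ?_))
  · exact (one_le_div hc₁).2 hc
  · exact (one_le_div hc₁).2 hx
  · rw [sub_nonneg, one_le_div hα₂]
    exact h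

/-- The key inequality between integrals of a convex function against two Pareto distributions. -/
lemma ConvexOn.exists_mul_distMean_sub_le_Par (hα₁ : 1 < α₁) (hα₂ : 1 < α₂) (hc₁ : 0 < c₁)
    (hc₂ : 0 < c₂) (h : α₂ < α₁ ∨ α₂ = α₁ ∧ c₁ ≤ c₂) {φ : ℝ → ℝ} (hφ : ConvexOn ℝ univ φ)
    (hi₁ : Integrable φ (Par α₁ c₁)) (hi₂ : Integrable φ (Par α₂ c₂)) :
    ∃ x₀, derivWithin φ (Ioi x₀) x₀ * (distMean (Par α₂ c₂) - distMean (Par α₁ c₁)) ≤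
      ∫ x, φ x ∂(Par α₂ c₂) - ∫ x, φ x ∂(Par α₁ c₁) := by
  have hα₁0 : 0 < α₁ := by linarith
  have hα₂0 : 0 < α₂ := by linarith
  obtain ⟨x₀, hx₀⟩ := exists_parTransport_expansive hα₂0 hc₁ hc₂ h
  refine ⟨x₀, ?_⟩
  have hid := integrable_id_Par hα₂ hc₂
  have hT : ∀ᵐ x ∂(Par α₁ c₁), (x₀ ≤ x → x ≤ parTransport α₁ c₁ α₂ c₂ x) ∧
      (x ≤ x₀ → parTransport α₁ c₁ α₂ c₂ x ≤ x) :=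
    (ae_le_Par hα₁0 hc₁).mono hx₀
  have hiT : Integrable (parTransport α₁ c₁ α₂ c₂) (Par α₁ c₁) :=
    integrable_comp_parTransport (φ := fun x => x) hα₁0 hα₂0 hc₁ hc₂ hid
  have key := hφ.mul_integral_sub_le_of_expansive x₀ hT (integrable_id_Par hα₁ hc₁) hiT hi₁
    (integrable_comp_parTransport hα₁0 hα₂0 hc₁ hc₂ hi₂)
  rw [integral_comp_parTransport hα₁0 hα₂0 hc₁ hc₂ hi₂,
    integral_comp_parTransport (φ := fun x => x) hα₁0 hα₂0 hc₁ hc₂ hid] at key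
  exact key

/-- With equal shapes, Pareto means are ordered as the scales. -/
lemma scale_le_of_distMean_Par_le {α : ℝ} (hα : 1 < α) (hc₁ : 0 < c₁) (hc₂ : 0 < c₂)
    (h : distMean (Par α c₁) ≤ distMean (Par α c₂)) : c₁ ≤ c₂ := by
  rw [distMean_Par hα hc₁, distMean_Par hα hc₂] at h
  refine le_of_mul_le_mul_right h (inv_pos.2 (sub_pos.2 ?_))
  rw [div_lt_one (by linarith)]
  exact hα

lemma shape_lt_or_of_distMean_le (hα₁ : 1 < α₁) (hc₁ : 0 < c₁) (hc₂ : 0 < c₂)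
    (hl : distMean (Par α₁ c₁) ≤ distMean (Par α₂ c₂)) (h : α₂ ≤ α₁) :
    α₂ < α₁ ∨ α₂ = α₁ ∧ c₁ ≤ c₂ := by
  rcases h.lt_or_eq with h | rfl
  · exact Or.inl h
  · exact Or.inr ⟨rfl, scale_le_of_distMean_Par_le hα₁ hc₁ hc₂ hl⟩

/-! ### Necessity, and the three characterisations -/

/-- If `α₁ < α₂`, the `p`-th moment of the first law blows up as `p ↑ α₁` while that of the second
stays bounded. -/
lemma IncreasingConvexOrder.shape_le (hα₁ : 1 < α₁) (hc₁ : 0 < c₁) (hc₂ : 0 < c₂)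
    (h : IncreasingConvexOrder (Par α₁ c₁) (Par α₂ c₂)) : α₂ ≤ α₁ := by
  by_contra! hlt
  -- Multiplying by `α₁ - p` clears the pole: the left side keeps a positive limit, the right side
  -- tends to `0`.
  have key : ∀ p ∈ Ioo 1 α₁, α₁ * c₁ ^ p ≤ α₂ * c₂ ^ p / (α₂ - p) * (α₁ - p) := by
    rintro p ⟨hp₁, hp₂⟩
    have := h _ ⟨monotone_max_rpow (p := p) (by linarith), convexOn_max_rpow hp₁.le⟩
      (integrable_max_rpow_Par (by linarith) hc₁ hp₂)
      (integrable_max_rpow_Par (by linarith) hc₂ (hp₂.trans hlt))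
    rwa [integral_max_rpow_Par (by linarith) hc₁ hp₂,
      integral_max_rpow_Par (by linarith) hc₂ (hp₂.trans hlt),
      div_le_iff₀ (by linarith)] at this
  have hL : Tendsto (fun p => α₁ * c₁ ^ p) (𝓝[<] α₁) (𝓝 (α₁ * c₁ ^ α₁)) :=
    ((continuousAt_const_rpow hc₁.ne').const_mul _ |>.tendsto).mono_left nhdsWithin_le_nhds
  have hR : Tendsto (fun p => α₂ * c₂ ^ p / (α₂ - p) * (α₁ - p)) (𝓝[<] α₁)
      (𝓝 (α₂ * c₂ ^ α₁ / (α₂ - α₁) * (α₁ - α₁))) := by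
    have hcont : ContinuousAt (fun p => α₂ * c₂ ^ p / (α₂ - p) * (α₁ - p)) α₁ := by
      have := continuousAt_const_rpow (b := α₁) hc₂.ne'
      have : α₂ - α₁ ≠ 0 := by linarith
      fun_prop (disch := assumption)
    exact hcont.tendsto.mono_left nhdsWithin_le_nhds
  have hle := le_of_tendsto_of_tendsto hL hR
    (eventually_of_mem (Ioo_mem_nhdsLT hα₁) key)
  rw [sub_self, mul_zero] at hle
  have : 0 < α₁ * c₁ ^ α₁ := by positivity
  linarith

/-- The function `min x c₁` attains its maximum almost surely under the first law, hence also under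
the second, which must then live on `[c₁, ∞)`. -/
lemma IncreasingConcaveOrder.scale_le (hα₁ : 1 < α₁) (hα₂ : 1 < α₂) (hc₁ : 0 < c₁) (hc₂ : 0 < c₂)
    (h : IncreasingConcaveOrder (Par α₁ c₁) (Par α₂ c₂)) : c₁ ≤ c₂ := by
  by_contra! hlt
  have hα₁0 : 0 < α₁ := by linarith
  have hα₂0 : 0 < α₂ := by linarith
  have := isProbabilityMeasure_Par hα₁0 hc₁
  have := isProbabilityMeasure_Par hα₂0 hc₂
  have hi₁ : Integrable (fun x => min x c₁) (Par α₁ c₁) :=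
    (integrable_id_Par hα₁ hc₁).inf (integrable_const c₁)
  have hi₂ : Integrable (fun x => min x c₁) (Par α₂ c₂) :=
    (integrable_id_Par hα₂ hc₂).inf (integrable_const c₁)
  have hle := h (fun x => min x c₁) ⟨fun _ _ hxy => min_le_min_right _ hxy,
    (concaveOn_id convex_univ).inf (concaveOn_const c₁ convex_univ)⟩ hi₁ hi₂
  have h₁ : ∫ x, min x c₁ ∂(Par α₁ c₁) = c₁ := by
    rw [integral_congr_ae (g := fun _ => c₁)]
    · simp
    · filter_upwards [ae_le_Par hα₁0 hc₁] with x hx using min_eq_right hx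
  have hnn : 0 ≤ fun x => c₁ - min x c₁ := fun x => sub_nonneg.2 (min_le_right _ _)
  have hzero : ∫ x, (c₁ - min x c₁) ∂(Par α₂ c₂) = 0 := by
    refine le_antisymm ?_ (integral_nonneg hnn)
    rw [integral_sub (integrable_const _) hi₂]
    simp only [integral_const, probReal_univ, one_smul]
    linarith
  rw [integral_eq_zero_iff_of_nonneg hnn ((integrable_const _).sub hi₂)] at hzero
  have hae : ∀ᵐ x ∂(Par α₂ c₂), x ∈ Ici c₁ := by
    filter_upwards [hzero] with x hx
    simp only [Pi.zero_apply] at hx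
    exact min_eq_right_iff.1 (sub_eq_zero.1 hx).symm
  have hone : Par α₂ c₂ (Ici c₁) = 1 := (prob_compl_eq_zero_iff measurableSet_Ici).1 hae
  rw [Par_Ici hα₂0 hc₂ hlt.le, ENNReal.ofReal_eq_one] at hone
  exact (rpow_lt_one (by positivity) ((div_lt_one hc₁).2 hlt) hα₂0).ne hone

lemma increasingConvexOrder_Par_iff (hα₁ : 1 < α₁) (hα₂ : 1 < α₂) (hc₁ : 0 < c₁) (hc₂ : 0 < c₂) :
    IncreasingConvexOrder (Par α₁ c₁) (Par α₂ c₂) ↔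
      distMean (Par α₁ c₁) ≤ distMean (Par α₂ c₂) ∧ α₁ ≥ α₂ := by
  constructor
  · intro h
    exact ⟨h _ ⟨monotone_id, convexOn_id convex_univ⟩ (integrable_id_Par hα₁ hc₁)
      (integrable_id_Par hα₂ hc₂), h.shape_le hα₁ hc₁ hc₂⟩
  · rintro ⟨hl, hα⟩ φ ⟨hm, hφ⟩ hi₁ hi₂
    obtain ⟨x₀, hx₀⟩ := hφ.exists_mul_distMean_sub_le_Par hα₁ hα₂ hc₁ hc₂
      (shape_lt_or_of_distMean_le hα₁ hc₁ hc₂ hl hα) hi₁ hi₂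
    have := mul_nonneg (hφ.rightDeriv_nonneg_of_monotone hm x₀) (sub_nonneg.2 hl)
    linarith

lemma convexOrder_Par_iff (hα₁ : 1 < α₁) (hα₂ : 1 < α₂) (hc₁ : 0 < c₁) (hc₂ : 0 < c₂) :
    ConvexOrder (Par α₁ c₁) (Par α₂ c₂) ↔
      distMean (Par α₁ c₁) = distMean (Par α₂ c₂) ∧ α₁ ≥ α₂ := by
  constructor
  · intro h
    have hicx : IncreasingConvexOrder (Par α₁ c₁) (Par α₂ c₂) := fun φ hφ => h φ hφ.2
    obtain ⟨hl, hα⟩ := (increasingConvexOrder_Par_iff hα₁ hα₂ hc₁ hc₂).1 hicx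
    refine ⟨hl.antisymm ?_, hα⟩
    have hneg := h (fun x => -x) (concaveOn_id convex_univ).neg (integrable_id_Par hα₁ hc₁).neg
      (integrable_id_Par hα₂ hc₂).neg
    rw [integral_neg, integral_neg] at hneg
    exact neg_le_neg_iff.1 hneg
  · rintro ⟨hl, hα⟩ φ hφ hi₁ hi₂
    obtain ⟨x₀, hx₀⟩ := ConvexOn.exists_mul_distMean_sub_le_Par hα₁ hα₂ hc₁ hc₂
      (shape_lt_or_of_distMean_le hα₁ hc₁ hc₂ hl.le hα) hφ hi₁ hi₂
    rw [hl, sub_self, mul_zero] at hx₀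
    exact sub_nonneg.1 hx₀

lemma increasingConcaveOrder_Par_iff (hα₁ : 1 < α₁) (hα₂ : 1 < α₂) (hc₁ : 0 < c₁) (hc₂ : 0 < c₂) :
    IncreasingConcaveOrder (Par α₁ c₁) (Par α₂ c₂) ↔
      distMean (Par α₁ c₁) ≤ distMean (Par α₂ c₂) ∧ c₁ ≤ c₂ := by
  have hα₁0 : 0 < α₁ := by linarith
  have hα₂0 : 0 < α₂ := by linarith
  constructor
  · intro h
    exact ⟨h _ ⟨monotone_id, concaveOn_id convex_univ⟩ (integrable_id_Par hα₁ hc₁)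
      (integrable_id_Par hα₂ hc₂), h.scale_le hα₁ hα₂ hc₁ hc₂⟩
  · rintro ⟨hl, hc⟩ φ ⟨hm, hφ⟩ hi₁ hi₂
    rcases le_or_gt α₂ α₁ with hα | hα
    · rw [← integral_comp_parTransport hα₁0 hα₂0 hc₁ hc₂ hi₂]
      refine integral_mono_ae hi₁ (integrable_comp_parTransport hα₁0 hα₂0 hc₁ hc₂ hi₂) ?_
      filter_upwards [ae_le_Par hα₁0 hc₁] with x hx
      exact hm (le_parTransport_self hα₂0 hc₁ hα hc hx)
    -- Here the second law has the lighter tail, so the laws swap roles and the convex function is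
    -- `-φ`.
    · obtain ⟨x₀, hx₀⟩ := hφ.neg.exists_mul_distMean_sub_le_Par hα₂ hα₁ hc₂ hc₁
        (Or.inl hα) hi₂.neg hi₁.neg
      have := mul_nonneg_of_nonpos_of_nonpos
        (hφ.neg.rightDeriv_nonpos_of_antitone hm.neg x₀) (sub_nonpos.2 hl)
      simp only [Pi.neg_apply, integral_neg] at hx₀
      linarith

end Transport

theorem mainTheorem5 (α₁ α₂ c₁ c₂ l₁ l₂ : ℝ) (μ₁ μ₂ : MeasureTheory.Measure ℝ)
    (hα₁ : 1 < α₁) (hα₂ : 1 < α₂) (hc₁ : 0 < c₁) (hc₂ : 0 < c₂)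
    (hμ₁ : μ₁ = Par α₁ c₁) (hμ₂ : μ₂ = Par α₂ c₂)
    (hl₁ : l₁ = distMean μ₁) (hl₂ : l₂ = distMean μ₂) :
    -- the means are finite and given by the explicit formula
    (MeasureTheory.Integrable (fun x : ℝ => x) μ₁ ∧ l₁ = c₁ * (1 - 1 / α₁)⁻¹) ∧
    (MeasureTheory.Integrable (fun x : ℝ => x) μ₂ ∧ l₂ = c₂ * (1 - 1 / α₂)⁻¹) ∧
    (IncreasingConvexOrder μ₁ μ₂ ↔ l₁ ≤ l₂ ∧ α₁ ≥ α₂) ∧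
    (ConvexOrder μ₁ μ₂ ↔ l₁ = l₂ ∧ α₁ ≥ α₂) ∧
    (IncreasingConcaveOrder μ₁ μ₂ ↔ l₁ ≤ l₂ ∧ c₁ ≤ c₂) := by
  subst hμ₁ hμ₂ hl₁ hl₂
  exact ⟨⟨integrable_id_Par hα₁ hc₁, distMean_Par hα₁ hc₁⟩,
    ⟨integrable_id_Par hα₂ hc₂, distMean_Par hα₂ hc₂⟩,
    increasingConvexOrder_Par_iff hα₁ hα₂ hc₁ hc₂,
    convexOrder_Par_iff hα₁ hα₂ hc₁ hc₂,
    increasingConcaveOrder_Par_iff hα₁ hα₂ hc₁ hc₂⟩
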